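/- **Conventions.** All automata are deterministic, with finite state set, over a fixed alphabet $A$, have a start state from which every state is reachable, and this start state is not reachable from itself by a non-empty word. Morphisms are state maps preserving the start state and commuting with the next-state function; $\mathbf A\twoheadleftarrow\mathbf B$ means that there is a surjective morphism $\mathbf B\to\mathbf A$. States $p,q$ are $\mathcal R$-equivalent if each is reachable from the other; a morphism is $1{:}1\mathcal R$ if it is injective on every $\mathcal R$-class. For a word $w$, $[w]$ is its class in the syntactic monoid of the automaton (words modulo equal action on all states), and $\mathrm{rank}_{\mathbf B}(w)$ is the largest $r$ such that there are regular $\mathcal J$-classes $[w]^\omega<_{\mathcal J}J_1<_{\mathcal J}\dots<_{\mathcal J}J_r$ in the syntactic monoid of $\mathbf B$, where $[w]^\omega$ is the idempotent power of $[w]$. A morphism $\psi:\mathbf X\to\mathbf B$ satisfies the *rank condition* if for every state $q$ of $\mathbf X$ and all $\alpha,\beta\in A^+$: $q\alpha=q$, $(q)\psi\,\beta=(q)\psi$ and $\mathrm{rank}_{\mathbf B}(\alpha)\ge\mathrm{rank}_{\mathbf B}(\beta)$ imply $q\beta=q$. The *glc-cover* of $[\mathbf A,\mathbf C]=\{\mathbf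 X:\mathbf A\twoheadleftarrow\mathbf X\twoheadleftarrow\mathbf C\}$ is the join, for $\twoheadleftarrow$, of all $\mathbf X\in[\mathbf A,\mathbf C]$ having a $1{:}1\mathcal R$ morphism onto $\mathbf A$ with the rank condition. The stabilizer of a state $q$ is the monoid $\{[w]: qw=q\}$; an $\mathcal L$-order is unambiguous if the elements above any given element form a chain. For a morphism $\psi:\mathbf C\to\mathbf A$ and an edge $(q,a)$ of $\mathbf C$ with $q$, $qa$ in the same $\mathcal R$-class, put $\mathrm{rank}_{\mathbf A}(q,a)=\min\{\mathrm{rank}_{\mathbf A}(ax): x\in A^*,\ qax=q\}$; edges of $\mathbf A$ are ranked with $\psi=\mathrm{id}_{\mathbf A}$. **The construction GLC** for $\varphi:\mathbf C\to\mathbf A$. A congruence $\bmod\varphi_1$ on the states of $\mathbf C$ is built by induction on the path-length $d$ from the start state, beginning with the identity relation. In step $d$, consider every state $\bar q$ at path-length $d$, with current class $\{\bar q_1,\dots,\bar q_\ell\}$, and every $a\in A$ such that $\bar qa$ is at larger path-length. Let $r=(\bar qa)\varphi$. For an integer $n$ let $\mathrm{paths}(r,n)$ be the set of words $t$ such that $rt\equiv_{\mathcal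 R}r$ and all edges of the walk $(r,t)$ have rank $\le n$. Put $n_1=$ the maximum of the ranks of the edges inside the $\mathcal R$-classes of $\bar q_1a,\dots,\bar q_\ell a$ (with $\max\varnothing=-1$) and $\bar P_1=\{\bar q_jat: t\in\mathrm{paths}(r,n_1),\ 1\le j\le\ell\}$; inductively $n_{i+1}=$ the maximum of the ranks of the edges inside the $\mathcal R$-classes of elements of $\bar P_i$ and $\bar P_{i+1}=$ the union of the $\mathcal R$-classes of the states $\bar q_jat$, $t\in\mathrm{paths}(r,n_{i+1})$, $1\le j\le\ell$. Let $\bar P_\infty=\bigcup_i\bar P_i$. Any two elements of $\bar P_\infty$ with the same image under $\varphi$ are identified; the new relation is the congruence generated by the old one and all the identifications made in step $d$. $\bmod\varphi_1$ is the union of all the relations so obtained, $\mathbf C^{GLC}=\mathbf C/\bmod\varphi_1$, $\varphi_1$ is the quotient map, and $\varphi_2:\mathbf C^{GLC}\to\mathbf A$ is induced by $\varphi$. **Proposition.** Let $\mathbf A$ be the right Cayley graph (with a new identity element adjoined as start state, restricted to the vertices reachable from it) of a finite $A$-generated monoid $M_A$ whose $\mathcal R$-order is a tree, and let $\varphi:\mathbf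 A^{\mathsf{cov}}\to\mathbf A$ be a morphism such that all stabilizers of $\mathbf A^{\mathsf{cov}}$ are $\mathcal R$-trivial bands with unambiguous $\mathcal L$-order. (1) Then $\mathsf{glc}=\mathsf{GLC}$. That is, $\varphi=\varphi_1\varphi_2$; $\varphi_2$ is $1{:}1\mathcal R$ and satisfies the rank condition; $\varphi_2$ is the maximal such right factor of $\varphi$ (whenever $\varphi=\theta_1\theta_2$ with surjective morphisms $\theta_1$, $\theta_2$ and $\theta_2$ is $1{:}1\mathcal R$ and satisfies the rank condition, $\bmod\varphi_1$ refines $\bmod\theta_1$); and an automaton is a glc-cover of $[\mathbf A,\mathbf A^{\mathsf{cov}}]$ if and only if it is isomorphic to the automaton $\mathbf C^{GLC}$ constructed from $\mathbf C=\mathbf A^{\mathsf{cov}}$. (2) If moreover all stabilizers of $\mathbf A$ are $\mathcal R$-trivial bands with unambiguous $\mathcal L$-order, the same holds for the variant of the construction in which the rank of an edge $(\bar q,a)$ of $\mathbf A^{\mathsf{cov}}$ is replaced by the rank in $\mathbf A$ of its image edge $((\bar q)\varphi,a)$. -/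

import Mathlib

universe u v

/-! ### Green's relations and the algebraic rank in a monoid -/

namespace Green

/-- `x ≤_R y`: `x` is a right multiple of `y`. -/
def RLe {S : Type*} [Monoid S] (x y : S) : Prop := ∃ u : S, x = y * u

/-- `x ≤_L y`: `x` is a left multiple of `y`. -/
def LLe {S : Type*} [Monoid S] (x y : S) : Prop := ∃ u : S, x = u * y

/-- `x ≤_J y`: `x` is a two-sided multiple of `y`. -/
def JLe {S : Type*} [Monoid S] (x y : S) : Prop := ∃ u v : S, x = u * y * v

/-- `x <_J y`. -/
def JLt {S : Type*} [Monoid S] (x y : S) : Prop := JLe x y ∧ ¬ JLe y x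

/-- Von Neumann regular elements. -/
def IsRegularElt {S : Type*} [Monoid S] (x : S) : Prop := ∃ y : S, x * y * x = x

/-- The `R`-order of the monoid is a tree: the elements above any given element
form a chain (the class of the identity is the root). -/
def ROrderIsTree (S : Type*) [Monoid S] : Prop :=
  ∀ x y z : S, RLe x y → RLe x z → RLe y z ∨ RLe z y

/-- The `L`-order is unambiguous: the elements above any given element form a chain. -/
def LOrderUnambiguous (S : Type*) [Monoid S] : Prop :=
  ∀ x y z : S, LLe x y → LLe x z → LLe y z ∨ LLe z y

/-- Every element is idempotent. -/
def IsBand (S : Type*) [Monoid S] : Prop := ∀ x : S, IsIdempotentElem x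

/-- Every `R`-class of the monoid is a singleton. -/
def IsRTrivial (S : Type*) [Monoid S] : Prop :=
  ∀ x y : S, RLe x y → RLe y x → x = y

/-- The algebraic rank of `x`: the largest `r` for which there is a strict chain
`x^ω <_J J₁ <_J ⋯ <_J J_r` of regular `J`-classes, where `x^ω` is the idempotent among the
positive powers of `x`. A chain of `J`-classes is given by a list of representatives. -/
noncomputable def rank {S : Type*} [Monoid S] (x : S) : ℕ :=
  sSup {r : ℕ | ∃ e : S, IsIdempotentElem e ∧ (∃ n : ℕ, 0 < n ∧ e = x ^ n) ∧
    ∃ l : List S, l.length = r ∧ (∀ j ∈ l, IsRegularElt j) ∧ List.IsChain JLt (e :: l)}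

end Green

/-- A finite deterministic automaton over the alphabet `α`, with a start state from which all
states are reachable and to which one cannot return. -/
structure TrimAut (α : Type v) where
  /-- the state set -/
  Q : Type u
  /-- the start state -/
  start : Q
  /-- the next-state function -/
  step : Q → α → Q
  finite : Finite Q
  trim : ∀ q : Q, ∃ w : List α, w.foldl step start = q
  no_return : ∀ (q : Q) (a : α), step q a ≠ start

namespace TrimAut

variable {α : Type v}

/-- The state reached from `q` by reading `w`. -/
def run (A : TrimAut.{u} α) (q : A.Q) (w : List α) : A.Q := w.foldl A.step q

theorem run_append (A : TrimAut.{u} α) (q : A.Q) (w x : List α) :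
    A.run q (w ++ x) = A.run (A.run q w) x := by
  simp [run, List.foldl_append]

/-- Morphisms: state maps that preserve the start state and commute with the next-state
functions. -/
structure Hom (A B : TrimAut.{u} α) where
  /-- the state map -/
  toFun : A.Q → B.Q
  map_start : toFun A.start = B.start
  map_step : ∀ (q : A.Q) (a : α), toFun (A.step q a) = B.step (toFun q) a

instance (A B : TrimAut.{u} α) : CoeFun (Hom A B) (fun _ => A.Q → B.Q) := ⟨Hom.toFun⟩

/-- The identity morphism. -/
def Hom.id (A : TrimAut.{u} α) : Hom A A := ⟨fun q => q, rfl, fun _ _ => rfl⟩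

/-- Composition of morphisms (first `f`, then `g`). -/
def Hom.comp {A B C : TrimAut.{u} α} (g : Hom B C) (f : Hom A B) : Hom A C :=
  ⟨fun q => g (f q), by simp [f.map_start, g.map_start],
    fun q a => by simp [f.map_step, g.map_step]⟩

/-- Isomorphism of automata. -/
def Iso (A B : TrimAut.{u} α) : Prop := ∃ f : Hom A B, Function.Bijective f

/-- `A ≤ B` iff there is a surjective morphism from `B` onto `A`. -/
instance : Preorder (TrimAut.{u} α) where
  le A B := ∃ f : Hom B A, Function.Surjective f
  le_refl A := ⟨Hom.id A, fun q => ⟨q, rfl⟩⟩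
  le_trans _ _ _ := fun ⟨f, hf⟩ ⟨g, hg⟩ => ⟨f.comp g, hf.comp hg⟩

/-- Mutual reachability of two states. -/
def REquiv (A : TrimAut.{u} α) (p q : A.Q) : Prop :=
  (∃ w : List α, A.run q w = p) ∧ ∃ w : List α, A.run p w = q

/-- The length of a shortest directed path from the start state to `q`. -/
noncomputable def dist (A : TrimAut.{u} α) (q : A.Q) : ℕ :=
  sInf {n : ℕ | ∃ w : List α, w.length = n ∧ A.run A.start w = q}

/-- The syntactic congruence on words: two words are equivalent iff they act in the same way
on all states. -/
def synCon (A : TrimAut.{u} α) : Con (FreeMonoid α) where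
  r x y := ∀ q : A.Q, A.run q x.toList = A.run q y.toList
  iseqv := ⟨fun _ _ => rfl, fun h q => (h q).symm, fun h k q => (h q).trans (k q)⟩
  mul' := by
    intro w x y z h k q
    simp only [FreeMonoid.toList_mul, run_append]
    rw [h q, k]

/-- The syntactic monoid. -/
abbrev Syn (A : TrimAut.{u} α) : Type v := A.synCon.Quotient

/-- The class `[w]` of a word in the syntactic monoid. -/
def cls (A : TrimAut.{u} α) (w : List α) : A.Syn := ((FreeMonoid.ofList w : FreeMonoid α) : A.Syn)

/-- The rank of a word with respect to an automaton. -/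
noncomputable def wordRank (A : TrimAut.{u} α) (w : List α) : ℕ := Green.rank (A.cls w)

/-- The (right) stabilizer of a state, inside the syntactic monoid. -/
def stab (A : TrimAut.{u} α) (q : A.Q) : Submonoid A.Syn where
  carrier := {s | ∃ w : List α, A.run q w = q ∧ A.cls w = s}
  one_mem' := ⟨[], rfl, rfl⟩
  mul_mem' := by
    rintro _ _ ⟨w, hw, rfl⟩ ⟨x, hx, rfl⟩
    exact ⟨w ++ x, by rw [run_append, hw, hx], rfl⟩

/-- All stabilizers are `R`-trivial bands with unambiguous `L`-order. -/
def StabilizersGood (A : TrimAut.{u} α) : Prop :=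
  ∀ q : A.Q, Green.IsBand (A.stab q) ∧ Green.IsRTrivial (A.stab q) ∧
    Green.LOrderUnambiguous (A.stab q)

/-- A morphism is `1:1R` iff it is injective on every reachability class. -/
def OneOneR {A B : TrimAut.{u} α} (f : Hom A B) : Prop :=
  ∀ p q : A.Q, A.REquiv p q → f p = f q → p = q

/-- The rank condition for a morphism `f : A → B`. -/
def RankCondition {A B : TrimAut.{u} α} (f : Hom A B) : Prop :=
  ∀ (q : A.Q) (x y : List α), x ≠ [] → y ≠ [] →
    A.run q x = q → B.run (f q) y = f q → B.wordRank y ≤ B.wordRank x → A.run q y = q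

/-- `G` is the glc-cover of the interval `[A, C]`: the join, in the order of automata, of all
members `X` of the interval that have a surjective `1:1R` morphism onto `A` satisfying the rank
condition. -/
def IsGlc (A C G : TrimAut.{u} α) : Prop :=
  IsLUB {X : TrimAut.{u} α | X ∈ Set.Icc A C ∧
    ∃ f : Hom X A, Function.Surjective f ∧ OneOneR f ∧ RankCondition f} G

/-- `φ = φ₂ ∘ φ₁` where `φ₂` is `1:1R`, satisfies the rank condition, and is the maximal
right factor of `φ` with these two properties: for every other such factorization `θ₂ ∘ θ₁`,
the kernel of `φ₁` refines the kernel of `θ₁`. -/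
structure IsMaximalFactor {A G C : TrimAut.{u} α} (φ : Hom C A) (φ₁ : Hom C G) (φ₂ : Hom G A) :
    Prop where
  factor : ∀ q : C.Q, φ₂ (φ₁ q) = φ q
  surj₁ : Function.Surjective φ₁
  surj₂ : Function.Surjective φ₂
  oneOneR : OneOneR φ₂
  rankCondition : RankCondition φ₂
  maximal : ∀ (B : TrimAut.{u} α) (θ₁ : Hom C B) (θ₂ : Hom B A),
    Function.Surjective θ₁ → Function.Surjective θ₂ → (∀ q : C.Q, θ₂ (θ₁ q) = φ q) →
    OneOneR θ₂ → RankCondition θ₂ → ∀ p q : C.Q, φ₁ p = φ₁ q → θ₁ p = θ₁ q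

/-! ### Right Cayley graphs -/

/-- The right Cayley graph of the monoid `M` with generators `σ`, as an automaton: the vertices
are the elements of `M` with a new identity element added (`WithOne M`) that are reachable from
this new element, which is the start state, and the edges are `(s, a, s * σ a)`. -/
def cayley {M : Type u} [Monoid M] [Finite M] (σ : α → M) : TrimAut.{u} α where
  Q := {x : WithOne M // ∃ w : List α, w.foldl (fun y a => y * (σ a : WithOne M)) 1 = x}
  start := ⟨1, [], rfl⟩
  step x a := ⟨x.1 * (σ a : WithOne M), by
    obtain ⟨w, hw⟩ := x.2
    exact ⟨w ++ [a], by rw [List.foldl_append, hw]; rfl⟩⟩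
  finite := by
    have : Finite (WithOne M) := inferInstanceAs (Finite (Option M))
    infer_instance
  trim := by
    rintro ⟨x, w, rfl⟩
    refine ⟨w, ?_⟩
    induction w using List.reverseRecOn with
    | nil => rfl
    | append_singleton w a ih =>
      rw [List.foldl_append, ih]
      apply Subtype.ext
      simp [List.foldl_append]
  no_return := by
    rintro ⟨x, hx⟩ a h
    have h' : x * (σ a : WithOne M) = 1 := congrArg Subtype.val h
    clear h hx
    induction x with
    | one => rw [one_mul] at h'; exact WithOne.coe_ne_one h'
    | coe m => rw [← WithOne.coe_mul] at h'; exact WithOne.coe_ne_one h'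

/-! ### The bottom-up construction -/

/-- The rank, measured in `B` by means of `f : A → B`, of the edge `(q, a)` of `A`:
the minimum of the ranks in `B` of the words `a x` that label a closed walk at `q` in `A`.
It is used only for edges inside a reachability class, where such walks exist. -/
noncomputable def edgeRank {A B : TrimAut.{u} α} (_f : Hom A B) (q : A.Q) (a : α) : ℕ :=
  sInf {n : ℕ | ∃ x : List α, A.run q (a :: x) = q ∧ n = B.wordRank (a :: x)}

/-- The rank, in `B` itself, of the image under `f` of the edge `(q, a)` of `A`. -/
noncomputable def imageEdgeRank {A B : TrimAut.{u} α} (f : Hom A B) (q : A.Q) (a : α) : ℕ :=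
  edgeRank (Hom.id B) (f q) a

/-- The labels of the walks that start at `r`, stay in the reachability class of `r`, and
whose edges all have rank at most `j`. -/
def paths (A : TrimAut.{u} α) (r : A.Q) (j : ℤ) : Set (List α) :=
  {w | A.REquiv (A.run r w) r ∧ ∀ (x : List α) (a : α) (y : List α), w = x ++ a :: y →
    (edgeRank (Hom.id A) (A.run r x) a : ℤ) ≤ j}

section Construction

variable {A C : TrimAut.{u} α} (φ : Hom C A) (rk : C.Q → α → ℕ)

/-- The largest rank (for the given ranking `rk` of the edges of `C`) of an edge inside the
reachability class of an element of `T`, and `-1` if there is no such edge. -/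
noncomputable def maxRank (rk : C.Q → α → ℕ) (T : Set C.Q) : ℤ :=
  sSup (insert (-1) {n : ℤ | ∃ p₀ ∈ T, ∃ (p : C.Q) (b : α),
    C.REquiv p p₀ ∧ C.REquiv (C.step p b) p ∧ n = rk p b})

/-- The sets `P₁ ⊆ P₂ ⊆ ⋯` (numbered from `0`) built from a class `K` of states of `C`, the
representative `q ∈ K` and the letter `a`. -/
noncomputable def stageP (K : Set C.Q) (q : C.Q) (a : α) : ℕ → Set C.Q
  | 0 => {p | ∃ k ∈ K, ∃ t ∈ A.paths (φ (C.step q a))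
      (maxRank rk {p' | ∃ k' ∈ K, p' = C.step k' a}), p = C.run (C.step k a) t}
  | i + 1 => {p | ∃ k ∈ K, ∃ t ∈ A.paths (φ (C.step q a)) (maxRank rk (stageP K q a i)),
      C.REquiv p (C.run (C.step k a) t)}

/-- `P_∞`. -/
def limitP (K : Set C.Q) (q : C.Q) (a : α) : Set C.Q := ⋃ i : ℕ, stageP φ rk K q a i

/-- The automaton congruence (equivalence relation stable under the next-state function)
generated by a relation. -/
inductive CongGen (C : TrimAut.{u} α) (r : C.Q → C.Q → Prop) : C.Q → C.Q → Prop
  | of {x y : C.Q} : r x y → CongGen C r x y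
  | refl (x : C.Q) : CongGen C r x x
  | symm {x y : C.Q} : CongGen C r x y → CongGen C r y x
  | trans {x y z : C.Q} : CongGen C r x y → CongGen C r y z → CongGen C r x z
  | step {x y : C.Q} (a : α) : CongGen C r x y → CongGen C r (C.step x a) (C.step y a)

/-- The congruence after stage `d` of the induction on the path-length from the start state.
At stage `0` no states are identified. At stage `d + 1` one takes all states `q` at path-length
`d`, with the class `K` of `q` constructed so far, and all letters `a` for which `q · a` is at
a larger path-length; any two elements of the resulting set `P_∞` with the same image under `φ`
are identified. -/
def glcStage : ℕ → C.Q → C.Q → Prop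
  | 0 => fun x y => x = y
  | d + 1 => CongGen C (fun x y => glcStage d x y ∨
      ∃ (q : C.Q) (a : α), C.dist q = d ∧ C.dist q < C.dist (C.step q a) ∧
        x ∈ limitP φ rk {k | glcStage d q k} q a ∧
        y ∈ limitP φ rk {k | glcStage d q k} q a ∧ φ x = φ y)

theorem glcStage_refl (d : ℕ) (x : C.Q) : glcStage φ rk d x x := by
  cases d with
  | zero => rfl
  | succ d => exact CongGen.refl x

theorem glcStage_symm {d : ℕ} {x y : C.Q} (h : glcStage φ rk d x y) : glcStage φ rk d y x := by
  cases d with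
  | zero => exact Eq.symm h
  | succ d => exact CongGen.symm h

theorem glcStage_trans {d : ℕ} {x y z : C.Q} (h : glcStage φ rk d x y)
    (k : glcStage φ rk d y z) : glcStage φ rk d x z := by
  cases d with
  | zero => exact Eq.trans h k
  | succ d => exact CongGen.trans h k

theorem glcStage_step {d : ℕ} {x y : C.Q} (a : α) (h : glcStage φ rk d x y) :
    glcStage φ rk d (C.step x a) (C.step y a) := by
  cases d with
  | zero => exact congrArg (fun z => C.step z a) h
  | succ d => exact CongGen.step a h

theorem glcStage_mono {d e : ℕ} (hde : d ≤ e) {x y : C.Q} (h : glcStage φ rk d x y) :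
    glcStage φ rk e x y := by
  induction hde with
  | refl => exact h
  | step _ ih => exact CongGen.of (Or.inl ih)

theorem glcStage_map {d : ℕ} {x y : C.Q} (h : glcStage φ rk d x y) : φ x = φ y := by
  induction d generalizing x y with
  | zero => exact congrArg φ h
  | succ d ih =>
    change CongGen C _ x y at h
    induction h with
    | of h =>
      rcases h with h | ⟨_, _, _, _, _, _, h⟩
      · exact ih h
      · exact h
    | refl => rfl
    | symm _ ih' => exact ih'.symm
    | trans _ _ ih₁ ih₂ => exact ih₁.trans ih₂
    | step a _ ih' => rw [φ.map_step, φ.map_step, ih']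

/-- The kernel of `φ₁`: the union of the congruences constructed at all stages. -/
def glcSetoid : Setoid C.Q where
  r x y := ∃ d : ℕ, glcStage φ rk d x y
  iseqv :=
    ⟨fun x => ⟨0, glcStage_refl φ rk 0 x⟩, fun ⟨d, h⟩ => ⟨d, glcStage_symm φ rk h⟩,
      fun ⟨d, h⟩ ⟨e, k⟩ => ⟨max d e, glcStage_trans φ rk
        (glcStage_mono φ rk (le_max_left d e) h) (glcStage_mono φ rk (le_max_right d e) k)⟩⟩

/-- The automaton resulting from the bottom-up construction: the quotient of `C` by the
constructed congruence. -/
def GLC : TrimAut.{u} α where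
  Q := Quotient (glcSetoid φ rk)
  start := Quotient.mk _ C.start
  step x a := Quotient.map (fun q => C.step q a)
    (fun x y (h : ∃ d : ℕ, glcStage φ rk d x y) =>
      h.elim fun d h => ⟨d, glcStage_step φ rk a h⟩) x
  finite := by
    have := C.finite
    infer_instance
  trim := by
    intro x
    induction x using Quotient.inductionOn with
    | h q =>
      obtain ⟨w, rfl⟩ := C.trim q
      refine ⟨w, ?_⟩
      induction w using List.reverseRecOn with
      | nil => rfl
      | append_singleton w a ih => simp only [List.foldl_append, ih]; rfl
  no_return := by
    intro x a
    induction x using Quotient.inductionOn with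
    | h q =>
      intro h
      obtain ⟨d, hd⟩ : (glcSetoid φ rk).r (C.step q a) C.start := Quotient.exact h
      have := glcStage_map φ rk hd
      rw [φ.map_step, φ.map_start] at this
      exact A.no_return _ _ this

/-- `φ₁`: a state is mapped to its class. -/
def glcFst : Hom C (GLC φ rk) where
  toFun := Quotient.mk (glcSetoid φ rk)
  map_start := rfl
  map_step _ _ := rfl

/-- `φ₂`: a class is mapped to the common image of its elements under `φ`. -/
def glcSnd : Hom (GLC φ rk) A where
  toFun := Quotient.lift φ.toFun (fun x y (h : ∃ d : ℕ, glcStage φ rk d x y) =>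
    h.elim fun _ h => glcStage_map φ rk h)
  map_start := φ.map_start
  map_step x a := by
    induction x using Quotient.inductionOn with
    | h q => exact φ.map_step q a

end Construction

end TrimAut

/-! Only two properties of an edge ranking matter (`AdmissibleRanking`): a loop has rank at least
that of its initial edge, and at most that of some edge on it. The first comes from the definition
as a minimum. The second holds in an automaton with good stabilizers: two loops `x`, `y` at a state
satisfy `[xy] = [x]` or `[yx] = [y]`, so a product of loops has rank at most the maximum of the two
ranks. If all edges of a loop `x` had smaller rank than `x`, `x` could be prolonged to a loop of
smaller rank; but prolonging a loop never lowers the rank, its class being idempotent.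

Maximality: let `θ₂ ∘ θ₁` be a competing factorization. Each bound `n_i ≥ 0` is at most the rank of
a loop in the class of an element of `P_i`. Moved to the current state, this loop lets the rank
condition for `θ₂` close every edge of a walk of rank at most `n_i`. Hence `θ₁` maps `P_∞` into one
reachability class, and `1:1R` forces all identifications (`AdmissibleRanking.glcStage_le`).

Conversely, take a loop of maximal rank `n` in a class of the quotient. An idempotent power of its
label fixes a lift `p`. The step that enters `p` from a state nearer the start identifies all
equally mapped ends of walks from `p` of rank at most `n` (`AdmissibleRanking.exists_base`). These
include all walks inside the class, which yields both conditions. As morphisms are unique, the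
maximal factor is the greatest member of the family defining the glc-cover. -/

namespace Green

/-! ### Rank in a finite monoid -/

variable {S : Type*} [Monoid S]

theorem JLe.refl (x : S) : JLe x x := ⟨1, 1, by simp⟩

theorem JLe.trans {x y z : S} (h : JLe x y) (k : JLe y z) : JLe x z := by
  obtain ⟨a, b, rfl⟩ := h
  obtain ⟨c, d, rfl⟩ := k
  exact ⟨a * c, d * b, by simp only [mul_assoc]⟩

theorem JLe.lt_trans {x y z : S} (h : JLe x y) (k : JLt y z) : JLt x z :=
  ⟨h.trans k.1, fun l => k.2 (l.trans h)⟩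

theorem JLt.trans {x y z : S} (h : JLt x y) (k : JLt y z) : JLt x z := h.1.lt_trans k

theorem exists_isIdempotentElem_pow [Finite S] (x : S) :
    ∃ n : ℕ, 0 < n ∧ IsIdempotentElem (x ^ n) := by
  obtain ⟨i, j, hij, h⟩ : ∃ i j : ℕ, i < j ∧ x ^ i = x ^ j := by
    obtain ⟨i, j, hne, h⟩ := Finite.exists_ne_map_eq_of_infinite (fun n : ℕ => x ^ n)
    rcases lt_or_gt_of_ne hne with hlt | hlt
    · exact ⟨i, j, hlt, h⟩
    · exact ⟨j, i, hlt, h.symm⟩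
  obtain ⟨c, hc, rfl⟩ : ∃ c, 0 < c ∧ j = i + c := ⟨j - i, by omega, by omega⟩
  have per : ∀ m, i ≤ m → ∀ k, x ^ (m + k * c) = x ^ m := by
    intro m hm k
    induction k with
    | zero => simp
    | succ k ih =>
      have e : m + (k + 1) * c = (i + c) + ((m - i) + k * c) := by
        rw [add_mul, one_mul]; omega
      have e' : m + k * c = i + ((m - i) + k * c) := by omega
      rw [e, pow_add, ← h, ← pow_add, ← e', ih]
  -- A multiple of the period `c` that is at least the index `i`.
  refine ⟨(i + 1) * c, by positivity, ?_⟩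
  rw [IsIdempotentElem, ← pow_add]
  exact per _ (by nlinarith) _

theorem eq_of_isIdempotentElem_pow {x : S} {m n : ℕ} (hm : 0 < m) (hn : 0 < n)
    (h : IsIdempotentElem (x ^ m)) (k : IsIdempotentElem (x ^ n)) : x ^ m = x ^ n := by
  rw [← h.pow_eq hn.ne', ← k.pow_eq hm.ne', ← pow_mul, ← pow_mul, mul_comm]

/-- Keeps the set in the definition of `rank` bounded; `sSup` of an unbounded set of naturals would
be `0`. -/
theorem length_le_card_of_isChain [Finite S] {e : S} {l : List S}
    (h : List.IsChain JLt (e :: l)) : l.length ≤ Nat.card S := by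
  have := Fintype.ofFinite S
  have : IsTrans S JLt := ⟨fun _ _ _ => JLt.trans⟩
  have hp := List.isChain_iff_pairwise.mp h
  have hn : (e :: l).Nodup := hp.imp fun {a b} (hab : JLt a b) (e : a = b) => by
    subst e
    exact hab.2 (JLe.refl a)
  rw [Nat.card_eq_fintype_card]
  exact (Nat.le_succ _).trans hn.length_le_card

theorem rank_le_card [Finite S] (x : S) : rank x ≤ Nat.card S := by
  refine csSup_le' ?_
  rintro r ⟨e, -, -, l, rfl, -, h⟩
  exact length_le_card_of_isChain h

/-- The rank is antitone in the `J`-class of the idempotent power. -/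
theorem rank_le_rank [Finite S] {x y : S} {k m : ℕ} (hk : 0 < k) (hm : 0 < m)
    (hx : IsIdempotentElem (x ^ k)) (h : JLe (y ^ m) (x ^ k)) : rank x ≤ rank y := by
  refine csSup_le' ?_
  rintro r ⟨e, he, ⟨n, hn, rfl⟩, l, rfl, hl, hc⟩
  rw [eq_of_isIdempotentElem_pow hn hk he hx] at hc
  -- `y ^ m` need not be idempotent; its idempotent power is still `J`-below `x ^ k`, so only the
  -- bottom link of the chain changes.
  obtain ⟨j, hj, hy⟩ := exists_isIdempotentElem_pow (y ^ m)
  have hle : JLe ((y ^ m) ^ j) (x ^ k) := by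
    refine JLe.trans ⟨1, (y ^ m) ^ (j - 1), ?_⟩ h
    rw [one_mul, ← pow_succ', Nat.sub_add_cancel hj]
  refine le_csSup ⟨Nat.card S, ?_⟩
    ⟨_, hy, ⟨m * j, Nat.mul_pos hm hj, (pow_mul _ _ _).symm⟩, l, rfl, hl, ?_⟩
  · rintro r ⟨e, -, -, l, rfl, -, h⟩
    exact length_le_card_of_isChain h
  · cases l with
    | nil => simp
    | cons a l =>
      rw [List.isChain_cons_cons] at hc ⊢
      exact ⟨hle.lt_trans hc.1, hc.2⟩

/-- From `(y * x) ^ (k + 1) = y * (x * y) ^ k * x`; hence rotating a loop preserves its rank. -/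
theorem rank_mul_comm_le [Finite S] (x y : S) : rank (x * y) ≤ rank (y * x) := by
  obtain ⟨k, hk, h⟩ := exists_isIdempotentElem_pow (x * y)
  refine rank_le_rank hk (Nat.succ_pos k) h ⟨y, x, ?_⟩
  have : ∀ n : ℕ, (y * x) ^ (n + 1) = y * (x * y) ^ n * x := by
    intro n
    induction n with
    | zero => simp
    | succ n ih => rw [pow_succ, ih, pow_succ]; simp only [mul_assoc]
  exact this k

theorem rank_mul_comm [Finite S] (x y : S) : rank (x * y) = rank (y * x) :=
  (rank_mul_comm_le x y).antisymm (rank_mul_comm_le y x)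

theorem rank_le_rank_pow [Finite S] (x : S) {n : ℕ} (hn : 0 < n) : rank x ≤ rank (x ^ n) := by
  obtain ⟨k, hk, h⟩ := exists_isIdempotentElem_pow x
  refine rank_le_rank hk hk h ?_
  rw [← pow_mul, mul_comm, pow_mul, h.pow_eq hn.ne']
  exact JLe.refl _

theorem rank_one [Finite S] : rank (1 : S) = 0 := by
  refine Nat.le_zero.mp (csSup_le' ?_)
  rintro r ⟨e, -, ⟨n, -, rfl⟩, l, rfl, -, hc⟩
  cases l with
  | nil => exact le_rfl
  | cons a l =>
    rw [List.isChain_cons_cons, one_pow] at hc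
    exact absurd ⟨a, 1, by simp⟩ hc.1.2

end Green

/-! ### Runs, morphisms and syntactic classes -/

namespace TrimAut

variable {α : Type v}

theorem run_cons (A : TrimAut.{u} α) (q : A.Q) (a : α) (w : List α) :
    A.run q (a :: w) = A.run (A.step q a) w := rfl

theorem exists_run_start (A : TrimAut.{u} α) (q : A.Q) : ∃ w, A.run A.start w = q := A.trim q

theorem Hom.map_run {A B : TrimAut.{u} α} (f : Hom A B) (q : A.Q) (w : List α) :
    f (A.run q w) = B.run (f q) w := by
  induction w generalizing q with
  | nil => rfl
  | cons a w ih => rw [run_cons, run_cons, ih, f.map_step]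

/-- Every state is reached from the start, whose image is prescribed. -/
theorem Hom.apply_eq {A B : TrimAut.{u} α} (f g : Hom A B) (q : A.Q) : f q = g q := by
  obtain ⟨w, rfl⟩ := A.exists_run_start q
  rw [f.map_run, g.map_run, f.map_start, g.map_start]

theorem Hom.surjective {A B : TrimAut.{u} α} (f : Hom A B) : Function.Surjective f := by
  intro q
  obtain ⟨w, rfl⟩ := B.exists_run_start q
  exact ⟨A.run A.start w, by rw [f.map_run, f.map_start]⟩

theorem run_ne_start (A : TrimAut.{u} α) (q : A.Q) {w : List α} (hw : w ≠ []) :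
    A.run q w ≠ A.start := by
  rcases List.eq_nil_or_concat w with rfl | ⟨v, a, rfl⟩
  · exact absurd rfl hw
  · rw [List.concat_eq_append, run_append]
    exact A.no_return _ a

theorem REquiv.refl (A : TrimAut.{u} α) (q : A.Q) : A.REquiv q q := ⟨⟨[], rfl⟩, ⟨[], rfl⟩⟩

theorem REquiv.symm {A : TrimAut.{u} α} {p q : A.Q} (h : A.REquiv p q) : A.REquiv q p :=
  ⟨h.2, h.1⟩

theorem REquiv.trans {A : TrimAut.{u} α} {p q r : A.Q} (h : A.REquiv p q) (k : A.REquiv q r) :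
    A.REquiv p r := by
  obtain ⟨⟨x, rfl⟩, ⟨y, hy⟩⟩ := h
  obtain ⟨⟨z, rfl⟩, ⟨t, ht⟩⟩ := k
  exact ⟨⟨z ++ x, run_append _ _ _ _⟩, ⟨y ++ t, by rw [run_append, hy, ht]⟩⟩

theorem REquiv.map {A B : TrimAut.{u} α} (f : Hom A B) {p q : A.Q} (h : A.REquiv p q) :
    B.REquiv (f p) (f q) := by
  obtain ⟨⟨x, hx⟩, ⟨y, hy⟩⟩ := h
  exact ⟨⟨x, by rw [← f.map_run, hx]⟩, ⟨y, by rw [← f.map_run, hy]⟩⟩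

theorem cls_append (A : TrimAut.{u} α) (x y : List α) : A.cls (x ++ y) = A.cls x * A.cls y := rfl

theorem cls_eq_iff (A : TrimAut.{u} α) {x y : List α} :
    A.cls x = A.cls y ↔ ∀ q, A.run q x = A.run q y := Con.eq _

theorem Hom.cls_eq {A B : TrimAut.{u} α} (f : Hom A B) {x y : List α} (h : A.cls x = A.cls y) :
    B.cls x = B.cls y := by
  rw [cls_eq_iff] at h ⊢
  intro q
  obtain ⟨p, rfl⟩ := f.surjective q
  rw [← f.map_run, ← f.map_run, h]

instance (A : TrimAut.{u} α) : Finite A.Syn := by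
  have := A.finite
  have hsurj : Function.Surjective A.cls := fun s => Con.induction_on s fun w => ⟨w.toList, rfl⟩
  choose g hg using hsurj
  refine Finite.of_injective (fun (s : A.Syn) (q : A.Q) => A.run q (g s)) fun s t h => ?_
  rw [← hg s, ← hg t, cls_eq_iff]
  exact congrFun h

theorem cls_flatten_replicate (A : TrimAut.{u} α) (n : ℕ) (x : List α) :
    A.cls (List.replicate n x).flatten = A.cls x ^ n := by
  induction n with
  | zero => rfl
  | succ n ih => rw [List.replicate_succ, List.flatten_cons, cls_append, ih, pow_succ']

theorem run_flatten_replicate (A : TrimAut.{u} α) {q : A.Q} {x : List α} (h : A.run q x = q)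
    (n : ℕ) : A.run q (List.replicate n x).flatten = q := by
  induction n with
  | zero => rfl
  | succ n ih => rw [List.replicate_succ, List.flatten_cons, run_append, h, ih]

theorem wordRank_le_card (A : TrimAut.{u} α) (w : List α) : A.wordRank w ≤ Nat.card A.Syn :=
  Green.rank_le_card _

theorem wordRank_nil (A : TrimAut.{u} α) : A.wordRank [] = 0 := Green.rank_one

theorem wordRank_append_comm (A : TrimAut.{u} α) (x y : List α) :
    A.wordRank (x ++ y) = A.wordRank (y ++ x) :=
  Green.rank_mul_comm (A.cls x) (A.cls y)

theorem wordRank_le_flatten_replicate (A : TrimAut.{u} α) (x : List α) {n : ℕ} (hn : 0 < n) :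
    A.wordRank x ≤ A.wordRank (List.replicate n x).flatten := by
  unfold wordRank
  rw [cls_flatten_replicate]
  exact Green.rank_le_rank_pow _ hn

/-- A loop can be moved to any state of its reachability class without lowering the rank (in a
quotient of the automaton). -/
theorem exists_loop_of_rEquiv {A B : TrimAut.{u} α} {p q : A.Q} (h : A.REquiv p q) {x : List α}
    (hx : x ≠ []) (hp : A.run p x = p) :
    ∃ y : List α, y ≠ [] ∧ A.run q y = q ∧ B.wordRank x ≤ B.wordRank y := by
  obtain ⟨⟨s, hs⟩, ⟨t, ht⟩⟩ := h
  obtain ⟨n, hn, hi⟩ := Green.exists_isIdempotentElem_pow (B.cls x)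
  -- Go from `q` to `p`, run the idempotent power of `x`, and return: the class lies `J`-below that
  -- idempotent.
  refine ⟨s ++ (List.replicate n x).flatten ++ t, ?_, ?_, ?_⟩
  · obtain ⟨m, rfl⟩ := Nat.exists_eq_succ_of_ne_zero hn.ne'
    simp [hx, List.replicate_succ]
  · rw [run_append, run_append, hs, run_flatten_replicate _ hp, ht]
  · refine Green.rank_le_rank hn one_pos hi ⟨B.cls s, B.cls t, ?_⟩
    rw [pow_one, cls_append, cls_append, cls_flatten_replicate]

/-! ### Loops in automata with good stabilizers -/

/-- In an automaton with good stabilizers any two loops at a state are `L`-comparable. -/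
theorem StabilizersGood.cls_mul_eq {A : TrimAut.{u} α} (hA : A.StabilizersGood) {q : A.Q}
    {x y : List α} (hx : A.run q x = q) (hy : A.run q y = q) :
    A.cls (x ++ y) = A.cls x ∨ A.cls (y ++ x) = A.cls y := by
  obtain ⟨hB, hR, hL⟩ := hA q
  let s : A.stab q := ⟨A.cls x, x, hx, rfl⟩
  let t : A.stab q := ⟨A.cls y, y, hy, rfl⟩
  -- Idempotency of `s * t` makes both sides `R`-equivalent. So `s * t` is `L`-below `s` as well as
  -- `t`, and unambiguity compares these two.
  have hst : s * t = s * t * s := hR _ _ ⟨t, by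
    have := hB (s * t)
    rw [IsIdempotentElem] at this
    rw [← mul_assoc] at this
    exact this.symm⟩ ⟨s, rfl⟩
  rcases hL (s * t) s t ⟨s * t, hst⟩ ⟨s, rfl⟩ with ⟨u, hu⟩ | ⟨u, hu⟩
  · left
    have : s * t = s := by
      rw [hu, mul_assoc, hB t]
    exact congrArg Subtype.val this
  · right
    have : t * s = t := by
      rw [hu, mul_assoc, hB s]
    exact congrArg Subtype.val this

theorem StabilizersGood.cls_idem {A : TrimAut.{u} α} (hA : A.StabilizersGood) {q : A.Q}
    {x : List α} (hx : A.run q x = q) : A.cls (x ++ x) = A.cls x :=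
  congrArg Subtype.val ((hA q).1 ⟨A.cls x, x, hx, rfl⟩)

theorem StabilizersGood.wordRank_append_le {A B : TrimAut.{u} α} (hA : A.StabilizersGood)
    (f : Hom A B) {q : A.Q} {x y : List α} (hx : A.run q x = q) (hy : A.run q y = q) :
    B.wordRank (x ++ y) ≤ max (B.wordRank x) (B.wordRank y) := by
  rcases hA.cls_mul_eq hx hy with h | h
  · exact le_max_of_le_left (congrArg Green.rank (f.cls_eq h)).le
  · rw [wordRank_append_comm]
    exact le_max_of_le_right (congrArg Green.rank (f.cls_eq h)).le

theorem StabilizersGood.wordRank_le_append {A B : TrimAut.{u} α} (hA : A.StabilizersGood)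
    (f : Hom A B) {q : A.Q} {x : List α} (hx : A.run q x = q) (y : List α) :
    B.wordRank x ≤ B.wordRank (x ++ y) := by
  have hi : IsIdempotentElem (B.cls x ^ 1) := by
    rw [pow_one]
    exact f.cls_eq (hA.cls_idem hx)
  refine Green.rank_le_rank one_pos one_pos hi ⟨1, B.cls y, ?_⟩
  rw [pow_one, pow_one, cls_append, one_mul]

theorem edgeRank_le {A B : TrimAut.{u} α} (f : Hom A B) {q : A.Q} {a : α} {x : List α}
    (h : A.run q (a :: x) = q) : edgeRank f q a ≤ B.wordRank (a :: x) :=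
  Nat.sInf_le ⟨x, h, rfl⟩

theorem exists_loop_edgeRank {A B : TrimAut.{u} α} (f : Hom A B) {q : A.Q} {a : α} {x : List α}
    (h : A.run q (a :: x) = q) :
    ∃ y : List α, A.run q (a :: y) = q ∧ edgeRank f q a = B.wordRank (a :: y) :=
  Nat.sInf_mem (s := {n : ℕ | ∃ x : List α, A.run q (a :: x) = q ∧ n = B.wordRank (a :: x)})
    ⟨_, x, h, rfl⟩

/-- Induction on the walk: an optimal loop `a y` through the first edge, rotated to `y a`, is
multiplied by the loop found for the rest; the product has rank at most the maximum. -/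
theorem StabilizersGood.exists_return {A B : TrimAut.{u} α} (hA : A.StabilizersGood)
    (f : Hom A B) {n : ℕ} (x : List α) : ∀ q : A.Q, (∃ z, A.run q (x ++ z) = q) →
    (∀ (s : List α) (a : α) (t : List α), x = s ++ a :: t → edgeRank f (A.run q s) a ≤ n) →
    ∃ z, A.run q (x ++ z) = q ∧ B.wordRank (x ++ z) ≤ n := by
  induction x with
  | nil =>
    intro q _ _
    exact ⟨[], rfl, by simp [wordRank_nil]⟩
  | cons a x ih =>
    rintro q ⟨z, hz⟩ hr
    obtain ⟨v, hv, hvn⟩ := ih (A.step q a) ⟨z ++ [a], by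
        rw [← List.append_assoc, run_append]
        exact congrArg (fun p => A.step p a) hz⟩ (fun s b t h => hr (a :: s) b t (by rw [h]; rfl))
    obtain ⟨y, hy, hya⟩ := exists_loop_edgeRank f hz
    have hyn : B.wordRank (a :: y) ≤ n := hya ▸ hr [] a x rfl
    have hloop : A.run (A.step q a) (y ++ [a]) = A.step q a := by
      rw [run_append]
      exact congrArg (fun p => A.step p a) hy
    refine ⟨v ++ y, ?_, ?_⟩
    · rw [List.cons_append, run_cons, ← List.append_assoc, run_append, hv]
      exact hy
    · have h₁ := hA.wordRank_append_le f hv hloop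
      have h₂ : B.wordRank (y ++ [a]) = B.wordRank (a :: y) := wordRank_append_comm B y [a]
      have h₃ : B.wordRank (a :: x ++ (v ++ y)) = B.wordRank (x ++ v ++ (y ++ [a])) := by
        have := wordRank_append_comm B [a] (x ++ v ++ y)
        simpa using this
      rw [h₃]
      exact h₁.trans (max_le hvn (h₂ ▸ hyn))

/-- In an automaton with good stabilizers the rank of a loop is the maximum of the ranks of its
edges. -/
theorem StabilizersGood.exists_wordRank_le_edgeRank {A B : TrimAut.{u} α}
    (hA : A.StabilizersGood) (f : Hom A B) {q : A.Q} {x : List α} (hx : x ≠ [])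
    (hq : A.run q x = q) : ∃ (s : List α) (a : α) (t : List α), x = s ++ a :: t ∧
      B.wordRank x ≤ edgeRank f (A.run q s) a := by
  by_contra! h
  have hpos : 0 < B.wordRank x := by
    obtain ⟨a, t, rfl⟩ := List.exists_cons_of_ne_nil hx
    exact (Nat.zero_le _).trans_lt (h [] a t rfl)
  obtain ⟨z, -, hz⟩ := hA.exists_return f (n := B.wordRank x - 1) x q ⟨[], by simpa using hq⟩
    fun s a t e => Nat.le_sub_one_of_lt (h s a t e)
  have := hA.wordRank_le_append f hq z
  omega

/-! ### Walks of bounded rank and distance from the start -/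

theorem mem_paths_of_loop {A B : TrimAut.{u} α} (f : Hom A B) {c : A.Q} {n : ℕ}
    (hn : ∀ c' y, A.REquiv c' c → y ≠ [] → A.run c' y = c' → B.wordRank y ≤ n) {w : List α}
    (hw : A.REquiv (A.run c w) c) : w ∈ B.paths (f c) n := by
  refine ⟨by rw [← f.map_run]; exact hw.map f, ?_⟩
  rintro s a t rfl
  obtain ⟨z, hz⟩ := hw.2
  have hs : A.REquiv (A.run c s) c :=
    ⟨⟨s, rfl⟩, a :: t ++ z, by rw [run_append, ← run_append _ c, hz]⟩
  have hloop : A.run (A.run c s) (a :: (t ++ z ++ s)) = A.run c s := by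
    have e : a :: (t ++ z ++ s) = (a :: t) ++ (z ++ s) := by simp
    rw [e, run_append, ← run_append _ c, run_append, hz]
  rw [← f.map_run]
  refine Nat.cast_le.mpr ((edgeRank_le (Hom.id B) (x := t ++ z ++ s) ?_).trans
    (hn _ _ hs (List.cons_ne_nil _ _) hloop))
  rw [← f.map_run, hloop]

/-- Each edge of the loop begins a rotation of it, which has the same rank. -/
theorem mem_paths_of_wordRank_le (A : TrimAut.{u} α) {r : A.Q} {y : List α} {n : ℕ}
    (hr : A.run r y = r) (hy : A.wordRank y ≤ n) : y ∈ A.paths r n := by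
  refine ⟨by rw [hr]; exact REquiv.refl A r, ?_⟩
  rintro s a t rfl
  refine Nat.cast_le.mpr ((edgeRank_le (Hom.id A) (x := t ++ s) ?_).trans ?_)
  · rw [← List.cons_append, run_append, ← run_append _ r, hr]
  · rwa [← List.cons_append, wordRank_append_comm]

theorem append_mem_paths (A : TrimAut.{u} α) {r : A.Q} {w y : List α} {j : ℤ}
    (hw : w ∈ A.paths r j) (hy : y ∈ A.paths (A.run r w) j) : w ++ y ∈ A.paths r j := by
  refine ⟨by rw [run_append]; exact hy.1.trans hw.1, fun s a t h => ?_⟩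
  rcases List.append_eq_append_iff.mp h with ⟨u, rfl, hu⟩ | ⟨u, rfl, hu⟩
  · rw [run_append]
    exact hy.2 u a t hu
  · cases u with
    | nil =>
      have := hy.2 [] a t (by simpa using hu.symm)
      simpa [run] using this
    | cons b u =>
      obtain ⟨rfl, -⟩ := List.cons.inj hu
      exact hw.2 s a u rfl

theorem paths_mono (A : TrimAut.{u} α) (r : A.Q) {i j : ℤ} (h : i ≤ j) :
    A.paths r i ⊆ A.paths r j :=
  fun _ hw => ⟨hw.1, fun x a y e => (hw.2 x a y e).trans h⟩

theorem dist_le_length (A : TrimAut.{u} α) (w : List α) : A.dist (A.run A.start w) ≤ w.length :=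
  Nat.sInf_le ⟨w, rfl, rfl⟩

theorem exists_length_eq_dist (A : TrimAut.{u} α) (q : A.Q) :
    ∃ w : List α, w.length = A.dist q ∧ A.run A.start w = q := by
  obtain ⟨w, hw⟩ := A.exists_run_start q
  exact Nat.sInf_mem (s := {n : ℕ | ∃ w : List α, w.length = n ∧ A.run A.start w = q})
    ⟨_, w, rfl, hw⟩

/-- Every state but the start state is entered by an edge from a state closer to the start. -/
theorem exists_step_eq_dist_lt (A : TrimAut.{u} α) {p : A.Q} (hp : p ≠ A.start) :
    ∃ (q : A.Q) (a : α), A.step q a = p ∧ A.dist q < A.dist p := by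
  obtain ⟨w, hl, rfl⟩ := A.exists_length_eq_dist p
  rcases List.eq_nil_or_concat w with rfl | ⟨v, a, rfl⟩
  · exact absurd rfl hp
  · refine ⟨A.run A.start v, a, ?_, ?_⟩
    · rw [List.concat_eq_append, run_append]; rfl
    · rw [← hl]
      exact (A.dist_le_length v).trans_lt (by simp)

/-! ### Admissible rankings of the edges -/

/-- A ranking of the edges is admissible if the rank (measured in the image of `φ`) of a loop is
at least the rank of its initial edge and at most the rank of one of its edges. -/
structure AdmissibleRanking {A C : TrimAut.{u} α} (_φ : Hom C A) (rk : C.Q → α → ℕ) : Prop where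
  le_wordRank : ∀ (q : C.Q) (a : α) (x : List α), C.run q (a :: x) = q →
    rk q a ≤ A.wordRank (a :: x)
  exists_wordRank_le : ∀ (q : C.Q) (x : List α), x ≠ [] → C.run q x = q →
    ∃ (s : List α) (a : α) (t : List α), x = s ++ a :: t ∧ A.wordRank x ≤ rk (C.run q s) a

theorem StabilizersGood.admissibleRanking_edgeRank {A C : TrimAut.{u} α} (hC : C.StabilizersGood)
    (φ : Hom C A) : AdmissibleRanking φ (edgeRank φ) where
  le_wordRank _ _ _ h := edgeRank_le φ h
  exists_wordRank_le _ _ hx h := hC.exists_wordRank_le_edgeRank φ hx h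

/-- Loops of `C` map to loops of `A`, so good stabilizers of `A` suffice here. -/
theorem StabilizersGood.admissibleRanking_imageEdgeRank {A C : TrimAut.{u} α}
    (hA : A.StabilizersGood) (φ : Hom C A) : AdmissibleRanking φ (imageEdgeRank φ) where
  le_wordRank _ _ _ h := edgeRank_le (Hom.id A) (by rw [← φ.map_run, h])
  exists_wordRank_le q x hx h := by
    obtain ⟨s, a, t, e, hr⟩ := hA.exists_wordRank_le_edgeRank (Hom.id A) (q := φ q) hx
      (by rw [← φ.map_run, h])
    exact ⟨s, a, t, e, by rwa [imageEdgeRank, φ.map_run]⟩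

section

variable {A C : TrimAut.{u} α} {φ : Hom C A} {rk : C.Q → α → ℕ}

theorem exists_loop_of_step_rEquiv {q : C.Q} {a : α} (h : C.REquiv (C.step q a) q) :
    ∃ x, C.run q (a :: x) = q := h.2

theorem AdmissibleRanking.bddAbove_maxRank (h : AdmissibleRanking φ rk) (T : Set C.Q) :
    BddAbove (insert (-1) {n : ℤ | ∃ p₀ ∈ T, ∃ (p : C.Q) (b : α),
      C.REquiv p p₀ ∧ C.REquiv (C.step p b) p ∧ n = rk p b}) := by
  refine ⟨Nat.card A.Syn, ?_⟩
  rintro n (rfl | ⟨p₀, -, p, b, -, hb, rfl⟩)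
  · omega
  · obtain ⟨x, hx⟩ := exists_loop_of_step_rEquiv hb
    exact Nat.cast_le.mpr ((h.le_wordRank p b x hx).trans (A.wordRank_le_card _))

theorem AdmissibleRanking.le_maxRank (h : AdmissibleRanking φ rk) {T : Set C.Q} {p₀ p : C.Q}
    {b : α} (h₀ : p₀ ∈ T) (hp : C.REquiv p p₀) (hb : C.REquiv (C.step p b) p) :
    (rk p b : ℤ) ≤ maxRank rk T :=
  le_csSup (h.bddAbove_maxRank T) (Or.inr ⟨p₀, h₀, p, b, hp, hb, rfl⟩)

theorem AdmissibleRanking.wordRank_le_maxRank (h : AdmissibleRanking φ rk) {T : Set C.Q}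
    {p : C.Q} (hp : p ∈ T) {x : List α} (hx : x ≠ []) (hl : C.run p x = p) :
    (A.wordRank x : ℤ) ≤ maxRank rk T := by
  obtain ⟨s, a, t, rfl, hr⟩ := h.exists_wordRank_le p x hx hl
  have ht : C.run (C.run p s) (a :: t) = p := by rw [← run_append, hl]
  refine (Nat.cast_le.mpr hr).trans
    (h.le_maxRank hp ⟨⟨s, rfl⟩, a :: t, ht⟩ ⟨⟨[a], rfl⟩, t ++ s, ?_⟩)
  rw [run_append]
  exact congrArg (fun p' => C.run p' s) ht

/-- A maximal rank of at least `0` is realized up to inequality by a loop. -/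
theorem AdmissibleRanking.exists_loop_maxRank_le (h : AdmissibleRanking φ rk) {T : Set C.Q}
    (hT : 0 ≤ maxRank rk T) : ∃ p₀ ∈ T, ∃ (p : C.Q) (x : List α), C.REquiv p p₀ ∧ x ≠ [] ∧
      C.run p x = p ∧ maxRank rk T ≤ A.wordRank x := by
  have hm : maxRank rk T ∈ insert (-1) {n : ℤ | ∃ p₀ ∈ T, ∃ (p : C.Q) (b : α),
      C.REquiv p p₀ ∧ C.REquiv (C.step p b) p ∧ n = rk p b} :=
    Int.csSup_mem (Set.insert_nonempty _ _) (h.bddAbove_maxRank T)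
  rcases hm with hm | ⟨p₀, h₀, p, b, hp, hb, e⟩
  · omega
  · obtain ⟨x, hx⟩ := exists_loop_of_step_rEquiv hb
    exact ⟨p₀, h₀, p, b :: x, hp, List.cons_ne_nil _ _, hx,
      e ▸ Nat.cast_le.mpr (h.le_wordRank p b x hx)⟩

/-! ### Maximality -/

variable {B : TrimAut.{u} α} {θ₁ : Hom C B} {θ₂ : Hom B A}

/-- Walks of bounded rank in `A` lift to walks in `B` that never leave the class of `c`: the rank
condition closes them edge by edge. -/
theorem AdmissibleRanking.rEquiv_run (h : AdmissibleRanking φ rk) (hθ : RankCondition θ₂)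
    {T : Set C.Q} (t : List α) : ∀ c : B.Q, t ∈ A.paths (θ₂ c) (maxRank rk T) →
      (∀ p ∈ T, B.REquiv (θ₁ p) c) → B.REquiv (B.run c t) c := by
  induction t with
  | nil => exact fun c _ _ => REquiv.refl B c
  | cons a t ih =>
    intro c ht hT
    obtain ⟨z, hz⟩ := ht.1.2
    rw [← run_append, List.cons_append] at hz
    obtain ⟨y, hy, hya⟩ := exists_loop_edgeRank (Hom.id A) hz
    have hle : (A.wordRank (a :: y) : ℤ) ≤ maxRank rk T := hya ▸ ht.2 [] a t rfl
    -- Having an edge within the bound excludes the default value `-1`, so a loop realizes the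
    -- bound.
    obtain ⟨p₀, h₀, p, x, hp, hx, hpx, hm⟩ :=
      h.exists_loop_maxRank_le ((Nat.cast_nonneg _).trans hle)
    obtain ⟨x', hx', hcx, hxx⟩ := exists_loop_of_rEquiv (B := A) ((hp.map θ₁).trans (hT p₀ h₀)) hx
      (by rw [← θ₁.map_run, hpx])
    have hc : B.run c (a :: y) = c := hθ c x' (a :: y) hx' (List.cons_ne_nil _ _) hcx hy
      (by exact_mod_cast hle.trans (hm.trans (Nat.cast_le.mpr hxx)))
    have hca : B.REquiv (B.step c a) c := ⟨⟨[a], rfl⟩, y, hc⟩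
    refine (ih (B.step c a) ⟨?_, fun s b u e => ?_⟩ fun p hp => (hT p hp).trans hca.symm).trans hca
    · have hr : A.REquiv (A.step (θ₂ c) a) (θ₂ c) := ⟨⟨[a], rfl⟩, y, hy⟩
      rw [θ₂.map_step]
      exact REquiv.trans ht.1 hr.symm
    · rw [θ₂.map_step]
      exact ht.2 (a :: s) b u (by rw [e]; rfl)

theorem AdmissibleRanking.rEquiv_of_mem_limitP (h : AdmissibleRanking φ rk)
    (hf : ∀ q, θ₂ (θ₁ q) = φ q) (hθ : RankCondition θ₂) {K : Set C.Q} {q : C.Q}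
    (hK : ∀ k ∈ K, θ₁ k = θ₁ q) {a : α} {p : C.Q} (hp : p ∈ limitP φ rk K q a) :
    B.REquiv (θ₁ p) (B.step (θ₁ q) a) := by
  have key : ∀ {T : Set C.Q} {t : List α}, (∀ p ∈ T, B.REquiv (θ₁ p) (B.step (θ₁ q) a)) →
      t ∈ A.paths (φ (C.step q a)) (maxRank rk T) → ∀ k ∈ K,
      B.REquiv (θ₁ (C.run (C.step k a) t)) (B.step (θ₁ q) a) := by
    intro T t hT ht k hk
    rw [θ₁.map_run, θ₁.map_step, hK k hk]
    refine h.rEquiv_run hθ t _ ?_ hT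
    rwa [← θ₁.map_step, hf]
  obtain ⟨i, hi⟩ := Set.mem_iUnion.mp hp
  clear hp
  induction i generalizing p with
  | zero =>
    obtain ⟨k, hk, t, ht, rfl⟩ := hi
    refine key ?_ ht k hk
    rintro _ ⟨k', hk', rfl⟩
    rw [θ₁.map_step, hK k' hk']
    exact REquiv.refl B _
  | succ i ih =>
    obtain ⟨k, hk, t, ht, hp⟩ := hi
    exact (hp.map θ₁).trans (key (fun p => ih) ht k hk)

theorem AdmissibleRanking.glcStage_le (h : AdmissibleRanking φ rk)
    (hf : ∀ q, θ₂ (θ₁ q) = φ q) (hone : OneOneR θ₂) (hθ : RankCondition θ₂) {d : ℕ} {x y : C.Q}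
    (hxy : glcStage φ rk d x y) : θ₁ x = θ₁ y := by
  induction d generalizing x y with
  | zero => exact congrArg θ₁ hxy
  | succ d ih =>
    change CongGen C _ x y at hxy
    induction hxy with
    | of hxy =>
      rcases hxy with hxy | ⟨q, a, -, -, hx, hy, e⟩
      · exact ih hxy
      · have hK : ∀ k ∈ {k | glcStage φ rk d q k}, θ₁ k = θ₁ q := fun k hk => (ih hk).symm
        refine hone _ _ ((h.rEquiv_of_mem_limitP hf hθ hK hx).trans
          (h.rEquiv_of_mem_limitP hf hθ hK hy).symm) ?_
        rw [hf, hf, e]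
    | refl => rfl
    | symm _ ih' => exact ih'.symm
    | trans _ _ ih₁ ih₂ => exact ih₁.trans ih₂
    | step a _ ih' => rw [θ₁.map_step, θ₁.map_step, ih']

/-! ### The quotient satisfies the two conditions -/

/-- Over each nontrivial reachability class of the quotient there is a state `p` such that the
construction has identified all states reached from `p` along walks of rank at most the maximal
rank of a loop of this class. -/
theorem AdmissibleRanking.exists_base (h : AdmissibleRanking φ rk) {c : (GLC φ rk).Q}
    {x : List α} (hx : x ≠ []) (hc : (GLC φ rk).run c x = c) :
    ∃ (p : C.Q) (n : ℕ), (GLC φ rk).REquiv (glcFst φ rk p) c ∧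
      (∀ c' y, (GLC φ rk).REquiv c' c → y ≠ [] → (GLC φ rk).run c' y = c' → A.wordRank y ≤ n) ∧
      ∀ w ∈ A.paths (φ p) n, ∀ w' ∈ A.paths (φ p) n, φ (C.run p w) = φ (C.run p w') →
        glcFst φ rk (C.run p w) = glcFst φ rk (C.run p w') := by
  let W : Set ℕ := {n | ∃ c' y, (GLC φ rk).REquiv c' c ∧ y ≠ [] ∧ (GLC φ rk).run c' y = c' ∧
    n = A.wordRank y}
  have hW : BddAbove W := by
    refine ⟨Nat.card A.Syn, ?_⟩
    rintro _ ⟨_, y, -, -, -, rfl⟩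
    exact A.wordRank_le_card y
  obtain ⟨c₁, y, hc₁, hy, hloop, hn⟩ := Nat.sSup_mem (s := W)
    ⟨_, c, x, REquiv.refl _ c, hx, hc, rfl⟩ hW
  obtain ⟨p₀, rfl⟩ := (glcFst φ rk).surjective c₁
  -- `y` fixes `c₁` but perhaps not its lift `p₀`; an idempotent power fixes `p₀ · y ^ N`, which
  -- also lies over `c₁`.
  obtain ⟨N, hN, hi⟩ := Green.exists_isIdempotentElem_pow (C.cls y)
  obtain ⟨z, hz⟩ : ∃ z, z = (List.replicate N y).flatten := ⟨_, rfl⟩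
  have hz₀ : z ≠ [] := by
    obtain ⟨m, rfl⟩ := Nat.exists_eq_succ_of_ne_zero hN.ne'
    simp [hz, hy, List.replicate_succ]
  obtain ⟨p, hp⟩ : ∃ p, p = C.run p₀ z := ⟨_, rfl⟩
  have hpz : C.run p z = p := by
    have : C.cls (z ++ z) = C.cls z := by
      rw [cls_append, hz, cls_flatten_replicate]
      exact hi
    rw [hp, ← run_append, (cls_eq_iff C).mp this]
  have hpc : glcFst φ rk p = glcFst φ rk p₀ := by
    rw [hp, hz, Hom.map_run, run_flatten_replicate _ hloop]
  have hnz : sSup W ≤ A.wordRank z := by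
    rw [hn, hz]
    exact A.wordRank_le_flatten_replicate y hN
  obtain ⟨q, a, hqa, hlt⟩ := C.exists_step_eq_dist_lt (p := p)
    (by rw [← hpz]; exact C.run_ne_start p hz₀)
  have hmem : ∀ w ∈ A.paths (φ p) (sSup W : ℕ),
      C.run p w ∈ limitP φ rk {k | glcStage φ rk (C.dist q) q k} q a := by
    intro w hw
    -- The first set `P₁` suffices: `z` is a loop at `p = q · a`, so `n₁` is at least its rank.
    refine Set.mem_iUnion.mpr ⟨0, q, glcStage_refl φ rk _ q, w, ?_, by rw [hqa]⟩
    rw [hqa]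
    refine A.paths_mono _ ((Nat.cast_le.mpr hnz).trans (h.wordRank_le_maxRank ?_ hz₀ hpz)) hw
    exact ⟨q, glcStage_refl φ rk _ q, hqa.symm⟩
  refine ⟨p, sSup W, hpc ▸ hc₁, fun c' y h₁ h₂ h₃ => le_csSup hW ⟨c', y, h₁, h₂, h₃, rfl⟩,
    fun w hw w' hw' e => Quotient.sound ⟨C.dist q + 1, CongGen.of (Or.inr
      ⟨q, a, rfl, hqa.symm ▸ hlt, hmem w hw, hmem w' hw', e⟩)⟩⟩

theorem glcSnd_glcFst (q : C.Q) : glcSnd φ rk (glcFst φ rk q) = φ q := rfl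

theorem AdmissibleRanking.oneOneR_glcSnd (h : AdmissibleRanking φ rk) :
    OneOneR (glcSnd φ rk) := by
  intro c₁ c₂ hc e
  by_contra hne
  obtain ⟨⟨s, hs⟩, ⟨t, ht⟩⟩ := id hc
  have hst : (GLC φ rk).run c₁ (t ++ s) = c₁ := by rw [run_append, ht, hs]
  have hst₀ : t ++ s ≠ [] := by
    intro h₀
    rw [(List.append_eq_nil_iff.mp h₀).1] at ht
    exact hne ht
  obtain ⟨p, n, hp, hn, hid⟩ := h.exists_base hst₀ hst
  have hn' : ∀ c' y, (GLC φ rk).REquiv c' (glcFst φ rk p) → y ≠ [] →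
      (GLC φ rk).run c' y = c' → A.wordRank y ≤ n := fun c' y h₁ => hn c' y (h₁.trans hp)
  obtain ⟨w₁, rfl⟩ := hp.symm.1
  obtain ⟨w₂, rfl⟩ := (hc.symm.trans hp.symm).1
  have h₁ := mem_paths_of_loop (glcSnd φ rk) hn' hp.symm
  have h₂ := mem_paths_of_loop (glcSnd φ rk) hn' (hc.symm.trans hp.symm)
  refine hne ?_
  rw [← Hom.map_run, ← Hom.map_run] at e ⊢
  exact hid _ h₁ _ h₂ e

theorem AdmissibleRanking.rankCondition_glcSnd (h : AdmissibleRanking φ rk) :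
    RankCondition (glcSnd φ rk) := by
  intro c x y hx hy hcx hcy hle
  obtain ⟨p, n, hp, hn, hid⟩ := h.exists_base hx hcx
  have hyn : A.wordRank y ≤ n := hle.trans (hn c x (REquiv.refl _ c) hx hcx)
  have hn' : ∀ c' y, (GLC φ rk).REquiv c' (glcFst φ rk p) → y ≠ [] →
      (GLC φ rk).run c' y = c' → A.wordRank y ≤ n := fun c' y h₁ => hn c' y (h₁.trans hp)
  obtain ⟨w, rfl⟩ := hp.symm.1
  have hw : w ∈ A.paths (φ p) n := mem_paths_of_loop (glcSnd φ rk) hn' hp.symm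
  rw [Hom.map_run (glcSnd φ rk), glcSnd_glcFst] at hcy
  -- `w` and `w ++ y` are both admissible from `p` and end at the same state of `A`, so their ends
  -- in `C` were identified.
  have hwy := A.append_mem_paths hw (A.mem_paths_of_wordRank_le hcy hyn)
  rw [← Hom.map_run, ← Hom.map_run, ← run_append]
  refine hid _ hwy _ hw ?_
  rw [φ.map_run, φ.map_run, run_append, hcy]

theorem AdmissibleRanking.isMaximalFactor (h : AdmissibleRanking φ rk) :
    IsMaximalFactor φ (glcFst φ rk) (glcSnd φ rk) where
  factor := glcSnd_glcFst
  surj₁ := Hom.surjective _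
  surj₂ := Hom.surjective _
  oneOneR := h.oneOneR_glcSnd
  rankCondition := h.rankCondition_glcSnd
  maximal B θ₁ θ₂ _ _ hf hone hθ p q hpq := by
    obtain ⟨d, hd⟩ := Quotient.exact hpq
    exact h.glcStage_le hf hone hθ hd

end

/-! ### The glc-cover -/

/-- A morphism whose kernel contains that of a surjective morphism factors through the latter. -/
theorem le_of_kernel_le {B C G : TrimAut.{u} α} {f : Hom C G} {g : Hom C B}
    (h : ∀ p q, f p = f q → g p = g q) : B ≤ G := by
  choose s hs using f.surjective
  refine ⟨⟨fun x => g (s x), ?_, fun x a => ?_⟩, Hom.surjective _⟩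
  · rw [← g.map_start]
    exact h _ _ (by rw [hs, f.map_start])
  · rw [← g.map_step]
    exact h _ _ (by rw [hs, f.map_step, hs])

theorem iso_iff_le_and_le {G H : TrimAut.{u} α} : Iso G H ↔ G ≤ H ∧ H ≤ G := by
  constructor
  · rintro ⟨f, hf⟩
    exact ⟨le_of_kernel_le (f := f) (g := Hom.id G) fun p q e => hf.1 e, f, hf.2⟩
  · rintro ⟨⟨g, -⟩, f, hf⟩
    exact ⟨f, fun p q e => ((g.comp f).apply_eq (Hom.id G) p).symm.trans
      ((congrArg g e).trans ((g.comp f).apply_eq (Hom.id G) q)), hf⟩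

theorem IsMaximalFactor.isGlc_iff {A G C : TrimAut.{u} α} {φ : Hom C A} {φ₁ : Hom C G}
    {φ₂ : Hom G A} (h : IsMaximalFactor φ φ₁ φ₂) (H : TrimAut.{u} α) :
    IsGlc A C H ↔ Iso H G := by
  -- With a greatest element, least upper bounds are exactly the automata equivalent to it in the
  -- preorder, that is, isomorphic to it.
  have hG : IsGreatest {X : TrimAut.{u} α | X ∈ Set.Icc A C ∧
      ∃ f : Hom X A, Function.Surjective f ∧ OneOneR f ∧ RankCondition f} G := by
    refine ⟨⟨⟨⟨φ₂, h.surj₂⟩, φ₁, h.surj₁⟩, φ₂, h.surj₂, h.oneOneR, h.rankCondition⟩, ?_⟩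
    rintro X ⟨⟨-, g, hg⟩, f, hf, hone, hrank⟩
    exact le_of_kernel_le (f := φ₁)
      (h.maximal X g f hg hf (fun q => (f.comp g).apply_eq φ q) hone hrank)
  rw [iso_iff_le_and_le]
  constructor
  · intro hH
    exact ⟨hH.2 hG.2, hH.1 hG.1⟩
  · rintro ⟨h₁, h₂⟩
    exact ⟨fun X hX => (hG.2 hX).trans h₂, fun Y hY => h₁.trans (hY hG.1)⟩

end TrimAut

theorem mainTheorem2 {α : Type v} {M : Type u} [Monoid M] [Finite M]
    (σ : α → M) (hσ : Submonoid.closure (Set.range σ) = ⊤)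
    (hM : Green.ROrderIsTree M)
    (C : TrimAut.{u} α) (φ : TrimAut.Hom C (TrimAut.cayley σ))
    (hC : C.StabilizersGood) :
    (TrimAut.IsMaximalFactor φ (TrimAut.glcFst φ (TrimAut.edgeRank φ))
        (TrimAut.glcSnd φ (TrimAut.edgeRank φ)) ∧
      ∀ G : TrimAut.{u} α, TrimAut.IsGlc (TrimAut.cayley σ) C G ↔
        TrimAut.Iso G (TrimAut.GLC φ (TrimAut.edgeRank φ))) ∧
    ((TrimAut.cayley σ).StabilizersGood →
      TrimAut.IsMaximalFactor φ (TrimAut.glcFst φ (TrimAut.imageEdgeRank φ))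
        (TrimAut.glcSnd φ (TrimAut.imageEdgeRank φ)) ∧
      ∀ G : TrimAut.{u} α, TrimAut.IsGlc (TrimAut.cayley σ) C G ↔
        TrimAut.Iso G (TrimAut.GLC φ (TrimAut.imageEdgeRank φ))) :=
  have h₁ := (hC.admissibleRanking_edgeRank φ).isMaximalFactor
  ⟨⟨h₁, h₁.isGlc_iff⟩, fun hA =>
    have h₂ := (hA.admissibleRanking_imageEdgeRank φ).isMaximalFactor
    ⟨h₂, h₂.isGlc_iff⟩⟩
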